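/- Notation. Identify the dual lattices $M$ and $N$ with $\mathbb{Z}^n$. A framed toric variety $(X,\mathbf a)$ is a complete toric variety $X=X(\Sigma)$ over $\mathbb{C}$, with $\Sigma$ a fan in $N_{\mathbb R}=\mathbb{R}^n$, together with a torus invariant Weil divisor $D_{\mathbf a}=\sum_{\rho\in\Sigma(1)}a_\rho D_\rho$ (a framing) with all $a_\rho>0$; let $v_\rho$ be the primitive generator of the ray $\rho$. Put $\Delta_{\mathbf a}=\{m\in M_{\mathbb R} : \langle m,v_\rho\rangle\ge -a_\rho\ \forall\rho\}$, $[\Delta]=\mathrm{conv}(\Delta\cap M)$, and $\Delta(X,\mathbf a)=[k_0\Delta_{\mathbf a}]$, where $k_0\ge 1$ is the least integer with $0\in\mathrm{Int}[k_0\Delta_{\mathbf a}]$. The $f$-dual of $(X,\mathbf a)$ is $(\mathbb{X}_{\mathbf a},\mathbf b)$, where $\mathbb{X}_{\mathbf a}$ is the toric variety whose fan consists of the faces of the cones projecting the facets of $\Delta(X,\mathbf a)$ from the origin, and $b_\lambda$ is, for every primitive generator $\lambda$ of a ray of this fan, the least positive integer with $\langle v_\rho,\lambda\rangle+b_\lambda\ge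 0$ for all $\rho$. The $f$-process of $(X,\mathbf a)$ is the double $f$-dual $(X,\mathbf a)\rightsquigarrow(\mathbb{X}_{\mathbf a},\mathbf b)\rightsquigarrow(\mathbb{X}_{\mathbf b},\mathbf c)$. It is calibrated if there are complete simplicial fans $\Xi$ and $\Xi'$, with the same rays as, and refining, the fans of $X$ and of $\mathbb{X}_{\mathbf b}$ respectively, with induced small resolutions $\varphi:Y(\Xi)\to X$ and $\varphi':Y'(\Xi')\to\mathbb{X}_{\mathbf b}$, and an isomorphism of toric varieties $f:Y(\Xi)\to Y'(\Xi')$ such that $\varphi^*D_{\mathbf a}=(\varphi'\circ f)^*D_{\mathbf c}$. Statement. Let $n\ge 2$ and $d\ge n+1$. Regard $\mathbb{P}^n$ over $\mathbb{C}$ as the toric variety with fan matrix $(e_1\ \cdots\ e_n\ \ -(e_1+\cdots+e_n))$ and torus invariant prime divisors $D_1,\dots,D_{n+1}$ (the coordinate hyperplanes), and put $\mathbf a_0=(1,\dots,1,d-n)$, that is, $D_{\mathbf a_0}=D_1+\cdots+D_n+(d-n)D_{n+1}$. Then $D_{\mathbf a_0}$ is a framing of $\mathbb{P}^n$, every hypersurface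 $Y_d\subset\mathbb{P}^n$ of degree $d$ is linearly equivalent to $D_{\mathbf a_0}$, and the $f$-process of $(\mathbb{P}^n,D_{\mathbf a_0})$ is calibrated. -/

import Mathlib

open CategoryTheory CategoryTheory.Limits AlgebraicGeometry
open scoped Pointwise

noncomputable section

namespace FDuality

/-! ### Lattice, cones and fans

The dual lattices `M` and `N` are both identified with `ℤⁿ`, the pairing being the standard one. -/

/-- Convex cones (with apex the origin) in `ℝⁿ`. -/
abbrev Cone (n : ℕ) := PointedCone ℝ (Fin n → ℝ)

/-- The inclusion of the lattice `ℤⁿ` in `ℝⁿ`. -/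
def lat {n : ℕ} (v : Fin n → ℤ) : Fin n → ℝ := fun i => (v i : ℝ)

/-- The cone is generated by finitely many lattice vectors. -/
def IsRational {n : ℕ} (σ : Cone n) : Prop :=
  ∃ S : Finset (Fin n → ℤ), σ = PointedCone.hull ℝ (lat '' (S : Set (Fin n → ℤ)))

/-- The cone contains no line. -/
def IsStronglyConvex {n : ℕ} (σ : Cone n) : Prop :=
  ∀ v ∈ σ, -v ∈ σ → v = 0

/-- `τ = σ ∩ u^⊥` for some `u` in the dual cone of `σ`. -/
def IsFace {n : ℕ} (τ σ : Cone n) : Prop :=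
  ∃ u : Fin n → ℝ, (∀ v ∈ σ, 0 ≤ dotProduct u v) ∧ ∀ v, v ∈ τ ↔ v ∈ σ ∧ dotProduct u v = 0

/-- Fans of strongly convex rational polyhedral cones in `ℝⁿ`. -/
structure IsFan {n : ℕ} (𝓕 : Set (Cone n)) : Prop where
  finite : 𝓕.Finite
  rational : ∀ σ ∈ 𝓕, IsRational σ
  stronglyConvex : ∀ σ ∈ 𝓕, IsStronglyConvex σ
  face_mem : ∀ σ ∈ 𝓕, ∀ τ, IsFace τ σ → τ ∈ 𝓕
  inter_face : ∀ σ ∈ 𝓕, ∀ τ ∈ 𝓕, IsFace (σ ⊓ τ) σ ∧ IsFace (σ ⊓ τ) τ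

/-- The support of the fan is the whole space. -/
def IsComplete {n : ℕ} (𝓕 : Set (Cone n)) : Prop := ∀ v : Fin n → ℝ, ∃ σ ∈ 𝓕, v ∈ σ

/-- The entries of `v` are coprime. -/
def IsPrimitive {n : ℕ} (v : Fin n → ℤ) : Prop := Finset.univ.gcd v = 1

/-- The `1`-skeleton `Σ(1)`, each ray being represented by its primitive generator. As a set of
lattice vectors it is the set of columns of a fan matrix of `Σ`. -/
def rays {n : ℕ} (𝓕 : Set (Cone n)) : Set (Fin n → ℤ) :=
  {v | IsPrimitive v ∧ PointedCone.hull ℝ {lat v} ∈ 𝓕}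

/-- `𝒮ℱ(V)`: complete simplicial fans whose rays are generated by the columns of `V`. -/
def SF {n : ℕ} (V : Set (Fin n → ℤ)) : Set (Set (Cone n)) :=
  {Ξ | IsFan Ξ ∧ IsComplete Ξ ∧ (∀ σ ∈ Ξ, σ.IsSimplicial) ∧ rays Ξ = V}

/-- Every cone of `Ξ` is contained in a cone of `Σ` (for complete fans, which have the same
support, this is refinement). -/
def Refines {n : ℕ} (Ξ 𝓕 : Set (Cone n)) : Prop := ∀ τ ∈ Ξ, ∃ σ ∈ 𝓕, τ ≤ σ

/-! ### Toric varieties over `ℂ` -/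

/-- The semigroup `S_σ = σ^∨ ∩ M`. -/
def semigroup {n : ℕ} (σ : Cone n) : AddSubmonoid (Fin n → ℤ) where
  carrier := {m | ∀ v ∈ σ, 0 ≤ dotProduct (lat m) v}
  zero_mem' := by
    intro v _
    have h : lat (0 : Fin n → ℤ) = 0 := by ext i; simp [lat]
    simp [h]
  add_mem' := by
    intro a b ha hb v hv
    have h : lat (a + b) = lat a + lat b := by ext i; simp [lat]
    rw [h, add_dotProduct]
    exact add_nonneg (ha v hv) (hb v hv)

theorem semigroup_anti {n : ℕ} {τ σ : Cone n} (h : τ ≤ σ) : semigroup σ ≤ semigroup τ :=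
  fun _ hm v hv => hm v (h hv)

/-- The coordinate ring `ℂ[S]` of an affine toric variety. -/
abbrev coordRing {n : ℕ} (S : AddSubmonoid (Fin n → ℤ)) : CommRingCat.{0} :=
  CommRingCat.of (AddMonoidAlgebra ℂ S)

/-- The inclusion `ℂ[S] → ℂ[S']` for `S ⊆ S'`. -/
def coordMap {n : ℕ} {S S' : AddSubmonoid (Fin n → ℤ)} (h : S ≤ S') :
    coordRing S ⟶ coordRing S' :=
  CommRingCat.ofHom (AddMonoidAlgebra.mapDomainRingHom ℂ (AddSubmonoid.inclusion h))

theorem coordMap_refl {n : ℕ} {S : AddSubmonoid (Fin n → ℤ)} (h : S ≤ S) :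
    coordMap h = 𝟙 (coordRing S) := by
  apply CommRingCat.hom_ext
  exact AddMonoidAlgebra.mapDomainRingHom_id

theorem coordMap_comp {n : ℕ} {S S' S'' : AddSubmonoid (Fin n → ℤ)} (h : S ≤ S') (h' : S' ≤ S'') :
    coordMap h ≫ coordMap h' = coordMap (h.trans h') := by
  apply CommRingCat.hom_ext
  exact (AddMonoidAlgebra.mapDomainRingHom_comp _ _).symm

/-- The affine toric variety `U_σ = Spec ℂ[S_σ]`. -/
abbrev affineToric {n : ℕ} (σ : Cone n) : LocallyRingedSpace.{0} :=
  Spec.toLocallyRingedSpace.obj (Opposite.op (coordRing (semigroup σ)))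

/-- The map `U_τ → U_σ` for `τ ⊆ σ`, dual to the inclusion `S_σ ⊆ S_τ`; it is an open immersion
if `τ` is a face of `σ`. -/
abbrev affineToricMap {n : ℕ} {τ σ : Cone n} (h : τ ≤ σ) : affineToric τ ⟶ affineToric σ :=
  Spec.toLocallyRingedSpace.map (coordMap (semigroup_anti h)).op

/-- The diagram of the affine toric varieties `U_σ`, `σ ∈ Σ`, and of the inclusions between them. -/
def toricDiagram {n : ℕ} (𝓕 : Set (Cone n)) : 𝓕 ⥤ LocallyRingedSpace.{0} where
  obj σ := affineToric (σ : Cone n)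
  map f := affineToricMap (leOfHom f)
  map_id σ := by
    rw [affineToricMap, coordMap_refl, op_id]
    exact Spec.toLocallyRingedSpace.map_id _
  map_comp f g := by
    rw [affineToricMap, affineToricMap, affineToricMap, ← Functor.map_comp, ← op_comp,
      coordMap_comp]

/-- The toric variety `X(Σ)`: the affine varieties `U_σ`, `σ ∈ Σ`, patched along the inclusions
`U_τ ↪ U_σ` given by common faces (`τ ⊆ σ` for two cones of a fan means that `τ` is a face of
`σ`). -/
def toricVariety {n : ℕ} (𝓕 : Set (Cone n)) : LocallyRingedSpace.{0} :=
  colimit (toricDiagram 𝓕)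

/-- The chart `U_σ → X(Σ)`. -/
def chart {n : ℕ} {𝓕 : Set (Cone n)} (σ : 𝓕) : affineToric (σ : Cone n) ⟶ toricVariety 𝓕 :=
  colimit.ι (toricDiagram 𝓕) σ

/-- The torus `T = Spec ℂ[M]`. -/
abbrev torus (n : ℕ) : LocallyRingedSpace.{0} :=
  Spec.toLocallyRingedSpace.obj
    (Opposite.op (CommRingCat.of (AddMonoidAlgebra ℂ (Fin n → ℤ))))

/-- The inclusion `T → U_σ → X(Σ)` of the torus, through the chart of `σ` (it does not depend on
`σ` if `Σ` is a fan). -/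
def torusInclusion {n : ℕ} {𝓕 : Set (Cone n)} (σ : 𝓕) : torus n ⟶ toricVariety 𝓕 :=
  Spec.toLocallyRingedSpace.map
    (CommRingCat.ofHom (AddMonoidAlgebra.mapDomainRingHom ℂ (semigroup (σ : Cone n)).subtype) :
      coordRing (semigroup (σ : Cone n)) ⟶
        CommRingCat.of (AddMonoidAlgebra ℂ (Fin n → ℤ))).op ≫ chart σ

/-- The isomorphism `f` is an isomorphism of toric varieties: it restricts to an isomorphism of
algebraic groups (that is, an isomorphism of Hopf algebras in the opposite direction) between the
tori. -/
def IsToricIso {n : ℕ} {Ξ Ξ' : Set (Cone n)} (f : toricVariety Ξ ≅ toricVariety Ξ') : Prop :=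
  ∃ θ : AddMonoidAlgebra ℂ (Fin n → ℤ) ≃ₐc[ℂ] AddMonoidAlgebra ℂ (Fin n → ℤ),
    ∀ (σ : Ξ) (σ' : Ξ'), torusInclusion σ ≫ f.hom =
      Spec.toLocallyRingedSpace.map
        (CommRingCat.ofHom (θ : AddMonoidAlgebra ℂ (Fin n → ℤ) →+*
          AddMonoidAlgebra ℂ (Fin n → ℤ))).op ≫ torusInclusion σ'

/-- `φ : X(Ξ) → X(Σ)` is the morphism of toric varieties induced by the identity of the lattice
`N`: on charts it is the map `U_τ → U_σ` dual to `S_σ ⊆ S_τ` whenever `τ ⊆ σ`. If `Ξ` refines `Σ`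
there is exactly one such morphism. -/
def IsRefinementMap {n : ℕ} {Ξ 𝓕 : Set (Cone n)} (φ : toricVariety Ξ ⟶ toricVariety 𝓕) : Prop :=
  ∀ (τ : Ξ) (σ : 𝓕) (h : (τ : Cone n) ≤ σ), chart τ ≫ φ = affineToricMap h ≫ chart σ

/-! ### Torus invariant divisors -/

/-- The closed orbit of the affine toric variety `U_σ`, i.e. the torus orbit of the distinguished
point `x_σ`: the common zeros of the characters in `S_σ` that do not vanish on all of `σ`. -/
def closedOrbit {n : ℕ} (σ : Cone n) : Set (affineToric σ) :=
  PrimeSpectrum.zeroLocus (R := AddMonoidAlgebra ℂ (semigroup σ))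
    {f | ∃ m : semigroup σ, (∃ v ∈ σ, dotProduct (lat (m : Fin n → ℤ)) v ≠ 0) ∧
      f = AddMonoidAlgebra.single m 1}

/-- The prime divisor `D_ρ ⊆ X(Σ)`: the closure of the torus orbit of `x_ρ`. -/
def rayDivisor {n : ℕ} {𝓕 : Set (Cone n)} (ρ : rays 𝓕) : Set (toricVariety 𝓕) :=
  closure ((chart (𝓕 := 𝓕) ⟨PointedCone.hull ℝ {lat (ρ : Fin n → ℤ)}, ρ.2.2⟩).base ''
    closedOrbit (PointedCone.hull ℝ {lat (ρ : Fin n → ℤ)}))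

open Classical in
/-- The torus invariant Weil divisor `D_a = ∑_ρ a_ρ D_ρ`, as the function sending a subset `Z`
of `X(Σ)` to the coefficient of `Z` in the sum. -/
def toricDivisor {n : ℕ} {𝓕 : Set (Cone n)} (a : rays 𝓕 → ℤ) (Z : Set (toricVariety 𝓕)) : ℤ :=
  ∑ᶠ ρ : rays 𝓕, if rayDivisor ρ = Z then a ρ else 0

/-- Prime Weil divisors: irreducible closed subsets of codimension one. -/
def PrimeDivisor (Y : LocallyRingedSpace.{0}) :=
  {W : TopologicalSpace.IrreducibleCloseds Y // Order.coheight W = 1}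

/-- The pull-back of a Weil divisor `D` through a morphism that is an isomorphism in codimension
one (a small birational contraction, an isomorphism, or a composition of them), which is the strict
transform of `D`: the coefficient of a prime divisor `W` is that of its image. -/
def pullback {Y X : LocallyRingedSpace.{0}} (φ : Y ⟶ X) (D : Set X → ℤ) (W : PrimeDivisor Y) : ℤ :=
  D (closure (φ.base '' (W.1 : Set Y)))

/-! ### Framed toric varieties and `f`-duality -/

/-- A set of cones in `ℝⁿ` together with an integer for each of its rays, that is, the
combinatorial datum of a toric variety `X(Σ)` with a torus invariant Weil divisor
`D_a = ∑_ρ a_ρ D_ρ`. -/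
structure DivisorData (n : ℕ) where
  fan : Set (Cone n)
  coeff : rays fan → ℤ

/-- `(X(Σ), D_a)` is a framed toric variety: `X(Σ)` is a complete toric variety and `D_a` is
strictly effective. -/
structure IsFramed {n : ℕ} (D : DivisorData n) : Prop where
  isFan : IsFan D.fan
  complete : IsComplete D.fan
  pos : ∀ ρ, 0 < D.coeff ρ

/-- The polyhedron `Δ_a = {m | ⟨m, v_ρ⟩ ≥ -a_ρ for every ρ}`. -/
def polyhedron {n : ℕ} (D : DivisorData n) : Set (Fin n → ℝ) :=
  {m | ∀ ρ : rays D.fan, -(D.coeff ρ : ℝ) ≤ dotProduct m (lat (ρ : Fin n → ℤ))}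

/-- The integer part `[Δ]`: the convex hull of the lattice points of `Δ`. -/
def integerPart {n : ℕ} (Δ : Set (Fin n → ℝ)) : Set (Fin n → ℝ) :=
  convexHull ℝ (Δ ∩ Set.range lat)

/-- `k₀ = min {k ≥ 1 | 0 ∈ Int [k Δ_a]}`. -/
def multiplier {n : ℕ} (D : DivisorData n) : ℕ :=
  sInf {k : ℕ | 1 ≤ k ∧ (0 : Fin n → ℝ) ∈ interior (integerPart ((k : ℝ) • polyhedron D))}

/-- The `f`-polytope `Δ(X, a) = [k₀ Δ_a]`. -/
def fPolytope {n : ℕ} (D : DivisorData n) : Set (Fin n → ℝ) :=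
  integerPart ((multiplier D : ℝ) • polyhedron D)

/-- `Φ` is a facet, i.e. a face of dimension `n - 1`, of the full dimensional polytope `Δ ⊆ ℝⁿ`. -/
def IsFacet {n : ℕ} (Φ Δ : Set (Fin n → ℝ)) : Prop :=
  ∃ (u : Fin n → ℝ) (c : ℝ), u ≠ 0 ∧ (∀ m ∈ Δ, -c ≤ dotProduct u m) ∧
    Φ = {m ∈ Δ | dotProduct u m = -c} ∧ Φ.Nonempty ∧
    Module.finrank ℝ (vectorSpan ℝ Φ) + 1 = n

/-- The fan `Σ_Δ` over the polytope `Δ ∋ 0`: the faces of the cones projecting from the origin the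
facets whose relative interior does not contain the origin. -/
def fanOver {n : ℕ} (Δ : Set (Fin n → ℝ)) : Set (Cone n) :=
  {τ | ∃ Φ, IsFacet Φ Δ ∧ (0 : Fin n → ℝ) ∉ intrinsicInterior ℝ Φ ∧
    IsFace τ (PointedCone.hull ℝ Φ)}

/-- The `f`-dual of `(X(Σ), a)`: the toric variety of the fan over `Δ(X, a)`, with the minimum
strictly positive `b` such that `⟨v_ρ, λ⟩ + b_λ ≥ 0` for all rays `v_ρ` of `Σ` and all rays `λ` of
the fan over `Δ(X, a)`. -/
def fDual {n : ℕ} (D : DivisorData n) : DivisorData n where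
  fan := fanOver (fPolytope D)
  coeff := fun l => ((sInf {b : ℕ | 0 < b ∧ ∀ v : rays D.fan,
    0 ≤ dotProduct (v : Fin n → ℤ) (l : Fin n → ℤ) + (b : ℤ)} : ℕ) : ℤ)

/-- The `f`-process `(X, a) ⇝ (𝕏_a, b) ⇝ (𝕏_b, c)` is calibrated: there are complete simplicial
fans `Ξ ∈ 𝒮ℱ(V)` and `Ξ' ∈ 𝒮ℱ(Λ_b)` refining the fans of `X` and `𝕏_b`, giving small resolutions
`φ : Y(Ξ) → X` and `φ' : Y'(Ξ') → 𝕏_b`, and an isomorphism of toric varieties `f : Y ≅ Y'` such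
that `φ^* D_a = (φ' ∘ f)^* D''_c`. -/
def IsCalibrated {n : ℕ} (D : DivisorData n) : Prop :=
  ∃ Ξ ∈ SF (rays D.fan), ∃ Ξ' ∈ SF (rays (fDual (fDual D)).fan),
    Refines Ξ D.fan ∧ Refines Ξ' (fDual (fDual D)).fan ∧
    ∃ (φ : toricVariety Ξ ⟶ toricVariety D.fan)
      (φ' : toricVariety Ξ' ⟶ toricVariety (fDual (fDual D)).fan)
      (f : toricVariety Ξ ≅ toricVariety Ξ'),
      IsRefinementMap φ ∧ IsRefinementMap φ' ∧ IsToricIso f ∧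
      pullback φ (toricDivisor D.coeff) =
        pullback (f.hom ≫ φ') (toricDivisor (fDual (fDual D)).coeff)

/-! ### Projective space -/

/-- The columns `e_1, …, e_n, -(e_1 + ⋯ + e_n)` of the fan matrix of `ℙⁿ`. -/
def projRay (n : ℕ) : Fin (n + 1) → (Fin n → ℤ) :=
  Fin.snoc (α := fun _ => Fin n → ℤ) (fun i => Pi.single i 1) (fun _ => -1)

/-- The fan of `ℙⁿ`: the cones generated by the proper subsets of the columns of its fan matrix. -/
def projFan (n : ℕ) : Set (Cone n) :=
  {σ | ∃ I : Set (Fin (n + 1)), I ≠ Set.univ ∧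
    σ = PointedCone.hull ℝ ((fun i => lat (projRay n i)) '' I)}

/-- `(ℙⁿ, D_a)` with `D_a = a_1 D_1 + ⋯ + a_{n+1} D_{n+1}`, where `D_i` is the torus invariant prime
divisor of the `i`-th column of the fan matrix. -/
def projData (n : ℕ) (a : Fin (n + 1) → ℤ) : DivisorData n where
  fan := projFan n
  coeff := fun ρ => ∑ i, if projRay n i = (ρ : Fin n → ℤ) then a i else 0

/-- The vector `(1, …, 1, d - n)`. -/
def framing₀ (n d : ℕ) : Fin (n + 1) → ℤ :=
  Fin.snoc (α := fun _ => ℤ) (fun _ : Fin n => (1 : ℤ)) ((d : ℤ) - n)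

attribute [local instance] MvPolynomial.gradedAlgebra

/-- Prime Weil divisors of `ℙⁿ`: points of codimension one of `Proj ℂ[x_1, …, x_{n+1}]`. -/
def ProjPrimeDivisor (n : ℕ) :=
  {P : ProjectiveSpectrum (MvPolynomial.homogeneousSubmodule (Fin (n + 1)) ℂ) //
    P.asHomogeneousIdeal.toIdeal.height = 1}

/-- The order of vanishing of a nonzero form `F` along the prime divisor `P` of `ℙⁿ`: the largest
`k` with `F ∈ P ^ k` (as an ideal `P` is generated by an irreducible form `p`, and this is the
exponent of `p` in the factorization of `F`). -/
def ordAlong {n : ℕ} (P : ProjPrimeDivisor n) (F : MvPolynomial (Fin (n + 1)) ℂ) : ℤ :=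
  ((sSup {k : ℕ | F ∈ P.1.asHomogeneousIdeal.toIdeal ^ k} : ℕ) : ℤ)

/-- The Weil divisor on `ℙⁿ` of the hypersurface `F = 0`, where `F` is a nonzero form. -/
def hypersurface {n : ℕ} (F : MvPolynomial (Fin (n + 1)) ℂ) (P : ProjPrimeDivisor n) : ℤ :=
  ordAlong P F

open Classical in
/-- The Weil divisor `D_a = ∑ a_i D_i` on `ℙⁿ`. In the homogeneous coordinates `x_1, …, x_{n+1}`,
which correspond to the columns of the fan matrix, `D_i` is the hyperplane `x_i = 0`. -/
def coordDivisor {n : ℕ} (a : Fin (n + 1) → ℤ) (P : ProjPrimeDivisor n) : ℤ :=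
  ∑ i, if P.1.asHomogeneousIdeal.toIdeal = Ideal.span {MvPolynomial.X i} then a i else 0

/-- Linear equivalence of Weil divisors on `ℙⁿ`: `D - D'` is the divisor of a nonzero rational
function `A / B`, with `A` and `B` nonzero forms of the same degree. -/
def LinearlyEquivalent {n : ℕ} (D D' : ProjPrimeDivisor n → ℤ) : Prop :=
  ∃ (e : ℕ) (A B : MvPolynomial (Fin (n + 1)) ℂ), A ≠ 0 ∧ B ≠ 0 ∧
    A.IsHomogeneous e ∧ B.IsHomogeneous e ∧
    ∀ P, D P - D' P = ordAlong P A - ordAlong P B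

end FDuality

end

/-!
The framing `(1, …, 1, d - n)` has the polytope `{m | m_i ≥ -1, ∑ m_i ≤ d - n}`, which is already a
lattice simplex with the origin in its interior; its vertices are `d e_i - (1, …, 1)` and
`-(1, …, 1)` (`dualRay`). Hence `k₀ = 1`, the f-dual is the fan over this simplex, and its framing is
`(d - n, …, d - n, 1)`. The polyhedron of this dual framing is a rational simplex in general, but the
only lattice points in it are the origin and the rays `e_i`, `-(1, …, 1)` of `ℙⁿ`
(`eq_zero_or_mem_range_projRay`), so that its integer part is the simplex spanned by the rays of
`ℙⁿ`, and the second f-dual is `ℙⁿ` with the original framing (`fDual_fDual_projData`). The fan of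
`ℙⁿ` is simplicial, so the f-process is calibrated by identity maps
(`isCalibrated_of_fDual_fDual_eq`).

Both fans are fans over lattice simplices around the origin, and are treated together through the
linear forms `u i` that equal `-1` on the facets (`IsSimplexAroundZero`): a cone of the fan consists
of the points at which the minimum of the `u j` is attained at the omitted indices
(`IsSimplexAroundZero.mem_hull_iff`), and the completeness, the strong convexity, the faces and the
intersections can be read off from this.

For the linear equivalence, a form `F` of degree `d` is compared with the monomial
`X_1 ⋯ X_n X_{n+1} ^ (d - n)`, whose divisor is the framing because a prime of height one that
contains a variable is generated by it (`ordAlong_prod_X_pow`).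
-/

namespace FDuality

/-! ### The fan over a simplex around the origin -/

/-- The origin lies in the interior of the simplex with vertices `v 0, …, v n`: its barycentric
coordinates are the positive numbers `c i`, and the facet opposite to `v i` lies in the hyperplane
`u i = -1`, so that the simplex is `{x | ∀ i, -1 ≤ ⟨u i, x⟩}`. -/
structure IsSimplexAroundZero {n : ℕ} (v : Fin (n + 1) → (Fin n → ℤ)) (c : Fin (n + 1) → ℝ)
    (u : Fin (n + 1) → (Fin n → ℝ)) : Prop where
  pos : ∀ i, 0 < c i
  sum_eq_one : ∑ i, c i = 1
  relation : ∑ i, c i • lat (v i) = 0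
  expand : ∀ x, ∑ i, (c i * dotProduct (u i) x) • lat (v i) = x
  apply_self : ∀ i, dotProduct (u i) (lat (v i)) = 1 / c i - 1
  apply_ne : ∀ i j, i ≠ j → dotProduct (u i) (lat (v j)) = -1

/-- The cones generated by the proper subsets of a family of `n + 1` vectors; `projFan n` is
`simplexFan (projRay n)`. -/
def simplexFan {n : ℕ} (v : Fin (n + 1) → (Fin n → ℤ)) : Set (Cone n) :=
  {σ | ∃ I : Set (Fin (n + 1)), I ≠ Set.univ ∧
    σ = PointedCone.hull ℝ ((fun i => lat (v i)) '' I)}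

theorem lat_injective {n : ℕ} : Function.Injective (lat (n := n)) := by
  intro a b h
  funext i
  exact Int.cast_injective (α := ℝ) (congrFun h i)

theorem hull_convexHull {n : ℕ} (s : Set (Fin n → ℝ)) :
    PointedCone.hull ℝ (convexHull ℝ s) = PointedCone.hull ℝ s := by
  apply le_antisymm
  · exact Submodule.span_le.2 (convexHull_min PointedCone.subset_hull (PointedCone.convex _))
  · exact Submodule.span_mono (subset_convexHull ℝ s)

theorem smul_mem_cone {n : ℕ} (σ : Cone n) {t : ℝ} (ht : 0 ≤ t) {x : Fin n → ℝ} (hx : x ∈ σ) :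
    t • x ∈ σ :=
  Submodule.smul_mem σ (⟨t, ht⟩ : { r : ℝ // 0 ≤ r }) hx

/-- The linear form `x ↦ ⟨u, x⟩` is nonnegative on the cone generated by `s` if it is so on `s`. -/
theorem dotProduct_nonneg_of_mem_hull {n : ℕ} {s : Set (Fin n → ℝ)} {u : Fin n → ℝ}
    (h : ∀ y ∈ s, 0 ≤ dotProduct u y) {x : Fin n → ℝ} (hx : x ∈ PointedCone.hull ℝ s) :
    0 ≤ dotProduct u x := by
  induction hx using Submodule.span_induction with
  | mem y hy => exact h y hy
  | zero => simp
  | add a b _ _ ha hb => rw [dotProduct_add]; exact add_nonneg ha hb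
  | smul t a _ ha =>
    rw [show t • a = (t : ℝ) • a from rfl, dotProduct_smul]
    exact mul_nonneg t.2 ha

theorem hull_le_hull {n : ℕ} {v : Fin (n + 1) → (Fin n → ℤ)} {I J : Set (Fin (n + 1))}
    (hIJ : I ⊆ J) : PointedCone.hull ℝ ((fun i => lat (v i)) '' I) ≤
      PointedCone.hull ℝ ((fun i => lat (v i)) '' J) :=
  Submodule.span_mono (Set.image_mono hIJ)

namespace IsSimplexAroundZero

variable {n : ℕ} {v : Fin (n + 1) → (Fin n → ℤ)} {c : Fin (n + 1) → ℝ}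
  {u : Fin (n + 1) → (Fin n → ℝ)}

theorem apply_sum (h : IsSimplexAroundZero v c u) (t : Fin (n + 1) → ℝ) (i : Fin (n + 1)) :
    dotProduct (u i) (∑ j, t j • lat (v j)) = t i / c i - ∑ j, t j := by
  have key : ∀ j, dotProduct (u i) (t j • lat (v j)) = (if i = j then t i / c i else 0) - t j := by
    intro j
    rw [dotProduct_smul, smul_eq_mul]
    split_ifs with hij
    · subst hij; rw [h.apply_self]; ring
    · rw [h.apply_ne i j hij]; ring
  rw [dotProduct_sum, Finset.sum_congr rfl fun j _ => key j]
  simp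

theorem sum_apply (h : IsSimplexAroundZero v c u) (x : Fin n → ℝ) :
    ∑ j, c j * dotProduct (u j) x = 0 := by
  have := h.apply_sum (fun j => c j * dotProduct (u j) x) 0
  rw [h.expand, mul_div_cancel_left₀ _ (h.pos 0).ne'] at this
  linarith

theorem expand_sub (h : IsSimplexAroundZero v c u) (x : Fin n → ℝ) (r : ℝ) :
    ∑ i, (c i * (dotProduct (u i) x - r)) • lat (v i) = x := by
  simp only [mul_sub, sub_smul, Finset.sum_sub_distrib, h.expand]
  simp only [mul_comm _ r, mul_smul, ← Finset.smul_sum, h.relation]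
  simp

/-- The numbers `c i * (⟨u i, x⟩ + 1)` are the barycentric coordinates of `x`; see
`sum_apply_add_one`. -/
theorem expand_add_one (h : IsSimplexAroundZero v c u) (x : Fin n → ℝ) :
    ∑ i, (c i * (dotProduct (u i) x + 1)) • lat (v i) = x := by
  simpa only [sub_neg_eq_add] using h.expand_sub x (-1)

theorem sum_apply_add_one (h : IsSimplexAroundZero v c u) (x : Fin n → ℝ) :
    ∑ i, c i * (dotProduct (u i) x + 1) = 1 := by
  simp only [mul_add, mul_one, Finset.sum_add_distrib, h.sum_apply, h.sum_eq_one, zero_add]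

theorem eq_zero_of_apply_eq (h : IsSimplexAroundZero v c u) {x : Fin n → ℝ} {r : ℝ}
    (hx : ∀ i, dotProduct (u i) x = r) : x = 0 := by
  rw [← h.expand x]
  simp only [hx, mul_comm _ r, mul_smul, ← Finset.smul_sum, h.relation, smul_zero]

/-- The cone over the vertices in `I` consists of the points at which the minimum of the linear
forms `u j` is attained at every index outside `I`. All properties of the fan are read off from this
description. -/
theorem mem_hull_iff (h : IsSimplexAroundZero v c u) {I : Set (Fin (n + 1))} (hI : I ≠ Set.univ)
    (x : Fin n → ℝ) :
    x ∈ PointedCone.hull ℝ ((fun i => lat (v i)) '' I) ↔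
      ∀ i ∉ I, ∀ j, dotProduct (u i) x ≤ dotProduct (u j) x := by
  constructor
  · intro hx i hi j
    have : 0 ≤ dotProduct (u j - u i) x := by
      refine dotProduct_nonneg_of_mem_hull ?_ hx
      rintro _ ⟨k, hk, rfl⟩
      have hik : i ≠ k := fun e => hi (e ▸ hk)
      rw [sub_dotProduct, h.apply_ne i k hik]
      by_cases hjk : j = k
      · subst hjk
        rw [h.apply_self]
        have := one_div_pos.2 (h.pos j)
        linarith
      · rw [h.apply_ne j k hjk]; simp
    rw [sub_dotProduct] at this
    linarith
  · intro hx
    obtain ⟨k, hk⟩ := (Set.ne_univ_iff_exists_notMem I).1 hI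
    rw [← h.expand_sub x (dotProduct (u k) x)]
    refine Submodule.sum_mem _ fun i _ => ?_
    by_cases hi : i ∈ I
    · exact smul_mem_cone _ (mul_nonneg (h.pos i).le (sub_nonneg.2 (hx k hk i)))
        (PointedCone.subset_hull ⟨i, hi, rfl⟩)
    · rw [le_antisymm (hx i hi k) (hx k hk i)]
      simp

theorem isFace_hull (h : IsSimplexAroundZero v c u) {I J : Set (Fin (n + 1))}
    (hI : I ≠ Set.univ) (hJI : J ⊆ I) :
    IsFace (PointedCone.hull ℝ ((fun i => lat (v i)) '' J))
      (PointedCone.hull ℝ ((fun i => lat (v i)) '' I)) := by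
  classical
  obtain ⟨k, hk⟩ := (Set.ne_univ_iff_exists_notMem I).1 hI
  have hJ : J ≠ Set.univ := fun e => hk (hJI (e ▸ Set.mem_univ k))
  have hn : ∀ x ∈ PointedCone.hull ℝ ((fun i => lat (v i)) '' I), ∀ i,
      0 ≤ dotProduct (u i - u k) x := by
    intro x hx i
    rw [sub_dotProduct, sub_nonneg]
    exact (h.mem_hull_iff hI x).1 hx k hk i
  -- each form `u i - u k` is nonnegative on the cone over `I`, and the cone over `J` is where those
  -- with `i ∈ I \ J` vanish
  refine ⟨∑ i ∈ Finset.univ.filter (fun i => i ∈ I \ J), (u i - u k), ?_, ?_⟩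
  · intro x hx
    rw [sum_dotProduct]
    exact Finset.sum_nonneg fun i _ => hn x hx i
  · intro x
    constructor
    · intro hx
      have hxI := hull_le_hull hJI hx
      refine ⟨hxI, ?_⟩
      rw [sum_dotProduct]
      refine Finset.sum_eq_zero fun i hi => ?_
      rw [Finset.mem_filter] at hi
      refine le_antisymm ?_ (hn x hxI i)
      rw [sub_dotProduct, sub_nonpos]
      exact (h.mem_hull_iff hJ x).1 hx i hi.2.2 k
    · rintro ⟨hx, h0⟩
      rw [sum_dotProduct, Finset.sum_eq_zero_iff_of_nonneg fun i _ => hn x hx i] at h0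
      rw [h.mem_hull_iff hJ]
      intro i hi j
      by_cases hiI : i ∈ I
      · have := h0 i (by simp [hi, hiI])
        rw [sub_dotProduct, sub_eq_zero] at this
        rw [this]
        exact (h.mem_hull_iff hI x).1 hx k hk j
      · exact (h.mem_hull_iff hI x).1 hx i hiI j

/-- A linear form that is nonnegative on a cone cuts out the cone over the generators on which it
vanishes. -/
theorem eq_hull_of_isFace (h : IsSimplexAroundZero v c u) {I : Set (Fin (n + 1))}
    (hI : I ≠ Set.univ) {τ : Cone n}
    (hτ : IsFace τ (PointedCone.hull ℝ ((fun i => lat (v i)) '' I))) :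
    ∃ J, J ⊆ I ∧ τ = PointedCone.hull ℝ ((fun i => lat (v i)) '' J) := by
  obtain ⟨w, hw, hmem⟩ := hτ
  refine ⟨{i | i ∈ I ∧ dotProduct w (lat (v i)) = 0}, fun i hi => hi.1, ?_⟩
  obtain ⟨k, hk⟩ := (Set.ne_univ_iff_exists_notMem I).1 hI
  apply le_antisymm
  · intro x hx
    obtain ⟨hxI, hx0⟩ := (hmem x).1 hx
    have hmin := (h.mem_hull_iff hI x).1 hxI
    have hcoef : ∀ i, 0 ≤ c i * (dotProduct (u i) x - dotProduct (u k) x) := fun i =>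
      mul_nonneg (h.pos i).le (sub_nonneg.2 (hmin k hk i))
    have e := h.expand_sub x (dotProduct (u k) x)
    have hterm : ∀ i, 0 ≤ (c i * (dotProduct (u i) x - dotProduct (u k) x)) *
        dotProduct w (lat (v i)) := by
      intro i
      by_cases hi : i ∈ I
      · exact mul_nonneg (hcoef i) (hw _ (PointedCone.subset_hull ⟨i, hi, rfl⟩))
      · rw [le_antisymm (hmin i hi k) (hmin k hk i)]; simp
    have hzero : ∀ i, (c i * (dotProduct (u i) x - dotProduct (u k) x)) *
        dotProduct w (lat (v i)) = 0 := by
      have := congrArg (dotProduct w) e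
      simp only [dotProduct_sum, dotProduct_smul, smul_eq_mul, hx0] at this
      rw [Finset.sum_eq_zero_iff_of_nonneg fun i _ => hterm i] at this
      exact fun i => this i (Finset.mem_univ i)
    rw [← e]
    refine Submodule.sum_mem _ fun i _ => ?_
    by_cases hi : i ∈ I
    · rcases mul_eq_zero.1 (hzero i) with h0 | h0
      · rw [h0]; simp
      · exact smul_mem_cone _ (hcoef i) (PointedCone.subset_hull ⟨i, ⟨hi, h0⟩, rfl⟩)
    · rw [le_antisymm (hmin i hi k) (hmin k hk i)]; simp
  · refine Submodule.span_le.2 ?_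
    rintro _ ⟨i, ⟨hi, h0⟩, rfl⟩
    exact (hmem _).2 ⟨PointedCone.subset_hull ⟨i, hi, rfl⟩, h0⟩

theorem hull_inf_hull (h : IsSimplexAroundZero v c u) {I J : Set (Fin (n + 1))}
    (hI : I ≠ Set.univ) (hJ : J ≠ Set.univ) :
    PointedCone.hull ℝ ((fun i => lat (v i)) '' I) ⊓
      PointedCone.hull ℝ ((fun i => lat (v i)) '' J) =
      PointedCone.hull ℝ ((fun i => lat (v i)) '' (I ∩ J)) := by
  have hIJ : I ∩ J ≠ Set.univ := fun e => hI (Set.eq_univ_of_univ_subset (e ▸ Set.inter_subset_left))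
  ext x
  rw [Submodule.mem_inf, h.mem_hull_iff hI, h.mem_hull_iff hJ, h.mem_hull_iff hIJ]
  constructor
  · rintro ⟨h1, h2⟩ i hi
    by_cases hiI : i ∈ I
    · exact h2 i fun hiJ => hi ⟨hiI, hiJ⟩
    · exact h1 i hiI
  · intro h1
    exact ⟨fun i hi => h1 i fun hh => hi hh.1, fun i hi => h1 i fun hh => hi hh.2⟩

theorem isFan (h : IsSimplexAroundZero v c u) : IsFan (simplexFan v) where
  finite := by
    refine (Set.finite_range fun I : Set (Fin (n + 1)) =>
      PointedCone.hull ℝ ((fun i => lat (v i)) '' I)).subset ?_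
    rintro _ ⟨I, _, rfl⟩
    exact ⟨I, rfl⟩
  rational := by
    classical
    rintro _ ⟨I, _, rfl⟩
    refine ⟨(Set.toFinite (v '' I)).toFinset, ?_⟩
    rw [Set.Finite.coe_toFinset, Set.image_image]
  stronglyConvex := by
    rintro _ ⟨I, hI, rfl⟩ x hx hx'
    obtain ⟨k, hk⟩ := (Set.ne_univ_iff_exists_notMem I).1 hI
    refine h.eq_zero_of_apply_eq (r := dotProduct (u k) x) fun i => le_antisymm ?_ ?_
    · have := (h.mem_hull_iff hI _).1 hx' k hk i
      rw [dotProduct_neg, dotProduct_neg] at this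
      linarith
    · exact (h.mem_hull_iff hI _).1 hx k hk i
  face_mem := by
    rintro _ ⟨I, hI, rfl⟩ τ hτ
    obtain ⟨J, hJ, rfl⟩ := h.eq_hull_of_isFace hI hτ
    exact ⟨J, fun e => hI (Set.eq_univ_of_univ_subset (e ▸ hJ)), rfl⟩
  inter_face := by
    rintro _ ⟨I, hI, rfl⟩ _ ⟨J, hJ, rfl⟩
    rw [h.hull_inf_hull hI hJ]
    exact ⟨h.isFace_hull hI Set.inter_subset_left, h.isFace_hull hJ Set.inter_subset_right⟩

theorem isComplete (h : IsSimplexAroundZero v c u) : IsComplete (simplexFan v) := by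
  intro x
  obtain ⟨k, hk⟩ := Finite.exists_min fun i => dotProduct (u i) x
  have hne : ({k}ᶜ : Set (Fin (n + 1))) ≠ Set.univ := by simp
  refine ⟨_, ⟨{k}ᶜ, hne, rfl⟩, (h.mem_hull_iff hne x).2 fun i hi j => ?_⟩
  obtain rfl : i = k := by simpa using hi
  exact hk j

theorem affineIndependent (h : IsSimplexAroundZero v c u) :
    AffineIndependent ℝ fun i => lat (v i) := by
  rw [affineIndependent_iff_of_fintype]
  intro t ht0 ht i
  rw [Finset.weightedVSub_eq_linear_combination _ ht0] at ht
  have := h.apply_sum t i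
  rw [ht, ht0, dotProduct_zero, sub_zero, eq_comm, div_eq_zero_iff] at this
  exact this.resolve_right (h.pos i).ne'

theorem isSimplicial (h : IsSimplexAroundZero v c u) {σ : Cone n} (hσ : σ ∈ simplexFan v) :
    σ.IsSimplicial := by
  obtain ⟨I, hI, rfl⟩ := hσ
  obtain ⟨k, hk⟩ := (Set.ne_univ_iff_exists_notMem I).1 hI
  refine ⟨_, (Set.toFinite I).image _, ?_, rfl⟩
  have hli : LinearIndepOn ℝ (fun i => lat (v i)) I := by
    classical
    rw [linearIndepOn_iff']
    intro s t hs ht i hi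
    have hks : k ∉ s := fun hks => hk (hs hks)
    have e : ∑ j, (if j ∈ s then t j else 0) • lat (v j) = 0 := by
      rw [← ht]
      simp [ite_smul, Finset.sum_ite_mem]
    have h1 := h.apply_sum (fun j => if j ∈ s then t j else 0) i
    have h2 := h.apply_sum (fun j => if j ∈ s then t j else 0) k
    rw [e] at h1 h2
    simp only [dotProduct_zero, hks, hi, if_true, if_false, zero_div] at h1 h2
    have : t i / c i = 0 := by linarith
    exact (div_eq_zero_iff.1 this).resolve_right (h.pos i).ne'
  exact hli.id_image

/-! ### The faces of the simplex -/

theorem mem_convexHull_iff (h : IsSimplexAroundZero v c u) (x : Fin n → ℝ) :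
    x ∈ convexHull ℝ (Set.range fun i => lat (v i)) ↔ ∀ i, -1 ≤ dotProduct (u i) x := by
  constructor
  · intro hx i
    refine convexHull_min (t := {y | -1 ≤ dotProduct (u i) y}) ?_ ?_ hx
    · rintro _ ⟨j, rfl⟩
      by_cases hij : i = j
      · subst hij
        have := one_div_pos.2 (h.pos i)
        simp only [Set.mem_ofPred_eq, h.apply_self]
        linarith
      · simp [h.apply_ne i j hij]
    · intro y hy z hz a b ha hb hab
      simp only [Set.mem_ofPred_eq, dotProduct_add, dotProduct_smul, smul_eq_mul] at hy hz ⊢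
      nlinarith
  · intro hx
    refine mem_convexHull_of_exists_fintype (fun i => c i * (dotProduct (u i) x + 1))
      (fun i => lat (v i)) (fun i => mul_nonneg (h.pos i).le (by linarith [hx i])) ?_
      (fun i => ⟨i, rfl⟩) ?_
    · exact h.sum_apply_add_one x
    · exact h.expand_add_one x

theorem zero_mem_interior (h : IsSimplexAroundZero v c u) :
    (0 : Fin n → ℝ) ∈ interior (convexHull ℝ (Set.range fun i => lat (v i))) := by
  rw [mem_interior]
  refine ⟨⋂ i, {x | -1 < dotProduct (u i) x}, ?_, ?_, ?_⟩
  · intro x hx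
    rw [Set.mem_iInter] at hx
    exact (h.mem_convexHull_iff x).2 fun i => (hx i).le
  · refine isOpen_iInter_of_finite fun i => isOpen_lt continuous_const ?_
    exact Continuous.dotProduct continuous_const continuous_id
  · simp

/-- A supporting hyperplane cuts out the convex hull of the vertices on it. -/
theorem face_eq_convexHull (h : IsSimplexAroundZero v c u) {w : Fin n → ℝ} {r : ℝ}
    (hw : ∀ m ∈ convexHull ℝ (Set.range fun i => lat (v i)), -r ≤ dotProduct w m) :
    {m ∈ convexHull ℝ (Set.range fun i => lat (v i)) | dotProduct w m = -r} =
      convexHull ℝ ((fun i => lat (v i)) '' {i | dotProduct w (lat (v i)) = -r}) := by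
  have hv : ∀ i, 0 ≤ dotProduct w (lat (v i)) + r := fun i => by
    linarith [hw _ (subset_convexHull ℝ _ ⟨i, rfl⟩)]
  apply Set.Subset.antisymm
  · rintro x ⟨hx, hxr⟩
    have hpos := (h.mem_convexHull_iff x).1 hx
    have e1 := h.sum_apply_add_one x
    have e2 := h.expand_add_one x
    have hc : ∀ i, 0 ≤ c i * (dotProduct (u i) x + 1) := fun i =>
      mul_nonneg (h.pos i).le (by linarith [hpos i])
    have e3 : ∑ i, (c i * (dotProduct (u i) x + 1)) * (dotProduct w (lat (v i)) + r) = 0 := by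
      simp only [mul_add _ _ r, Finset.sum_add_distrib, ← Finset.sum_mul, e1]
      have := congrArg (dotProduct w) e2
      simp only [dotProduct_sum, dotProduct_smul, smul_eq_mul] at this
      rw [this, hxr]
      ring
    rw [Finset.sum_eq_zero_iff_of_nonneg fun i _ => mul_nonneg (hc i) (hv i)] at e3
    rw [← e2, ← finsum_eq_sum_of_fintype]
    refine (convex_convexHull ℝ _).finsum_mem hc (by rw [finsum_eq_sum_of_fintype, e1]) ?_
    intro i hi
    refine subset_convexHull ℝ _ ⟨i, ?_, rfl⟩
    have := (mul_eq_zero.1 (e3 i (Finset.mem_univ i))).resolve_left hi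
    simp only [Set.mem_ofPred_eq]
    linarith
  · refine convexHull_min ?_ ?_
    · rintro _ ⟨i, hi, rfl⟩
      exact ⟨subset_convexHull ℝ _ ⟨i, rfl⟩, hi⟩
    · rintro y ⟨hy, hy'⟩ z ⟨hz, hz'⟩ a b ha hb hab
      refine ⟨convex_convexHull ℝ _ hy hz ha hb hab, ?_⟩
      rw [dotProduct_add, dotProduct_smul, dotProduct_smul, hy', hz', smul_eq_mul, smul_eq_mul,
        ← add_mul, hab, one_mul]

theorem setOf_apply_eq_neg_one (h : IsSimplexAroundZero v c u) (k : Fin (n + 1)) :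
    {i | dotProduct (u k) (lat (v i)) = -1} = {k}ᶜ := by
  ext i
  simp only [Set.mem_ofPred_eq, Set.mem_compl_iff, Set.mem_singleton_iff]
  constructor
  · rintro hi rfl
    rw [h.apply_self] at hi
    have := one_div_pos.2 (h.pos i)
    linarith
  · intro hi
    exact h.apply_ne k i (Ne.symm hi)

theorem isFacet (h : IsSimplexAroundZero v c u) (hn : 1 ≤ n) (k : Fin (n + 1)) :
    IsFacet (convexHull ℝ ((fun i => lat (v i)) '' {k}ᶜ))
      (convexHull ℝ (Set.range fun i => lat (v i))) := by
  classical
  have hw : ∀ m ∈ convexHull ℝ (Set.range fun i => lat (v i)), -1 ≤ dotProduct (u k) m :=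
    fun m hm => (h.mem_convexHull_iff m).1 hm k
  have : Nontrivial (Fin (n + 1)) := Fin.nontrivial_iff_two_le.2 (by omega)
  obtain ⟨j, hj⟩ := exists_ne k
  refine ⟨u k, 1, ?_, hw, ?_, ?_, ?_⟩
  · intro e
    have := h.apply_ne k j hj.symm
    rw [e, zero_dotProduct] at this
    norm_num at this
  · rw [h.face_eq_convexHull hw, h.setOf_apply_eq_neg_one]
  · exact ⟨_, subset_convexHull ℝ _ ⟨j, hj, rfl⟩⟩
  · rw [← direction_affineSpan, affineSpan_convexHull, direction_affineSpan]
    have hs : ({k}ᶜ : Set (Fin (n + 1))) = ((Finset.univ.erase k : Finset (Fin (n + 1))) : Set _) := by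
      ext; simp
    have := h.affineIndependent.finrank_vectorSpan_image_finset (s := Finset.univ.erase k)
      (n := n - 1) (by rw [Finset.card_erase_of_mem (Finset.mem_univ k)]; simp; omega)
    rw [hs, ← Finset.coe_image, this]
    omega

theorem fanOver_eq (h : IsSimplexAroundZero v c u) (hn : 1 ≤ n) :
    fanOver (convexHull ℝ (Set.range fun i => lat (v i))) = simplexFan v := by
  apply Set.Subset.antisymm
  · rintro τ ⟨Φ, ⟨w, r, hw0, hw, rfl, -, -⟩, -, hτ⟩
    rw [h.face_eq_convexHull hw, hull_convexHull] at hτ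
    have hI : {i | dotProduct w (lat (v i)) = -r} ≠ Set.univ := by
      intro e
      have hv : ∀ i, dotProduct w (lat (v i)) = -r := fun i => e.symm.subset (Set.mem_univ i)
      have hr : r = 0 := by
        have := congrArg (dotProduct w) h.relation
        simp only [dotProduct_sum, dotProduct_smul, smul_eq_mul, hv, ← Finset.sum_mul,
          h.sum_eq_one, dotProduct_zero] at this
        linarith
      refine hw0 (dotProduct_self_eq_zero.1 ?_)
      have := congrArg (dotProduct w) (h.expand w)
      rw [← this, dotProduct_sum]
      simp [hv, hr]
    obtain ⟨J, hJ, rfl⟩ := h.eq_hull_of_isFace hI hτ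
    exact ⟨J, fun e => hI (Set.eq_univ_of_univ_subset (e ▸ hJ)), rfl⟩
  · rintro _ ⟨I, hI, rfl⟩
    obtain ⟨k, hk⟩ := (Set.ne_univ_iff_exists_notMem I).1 hI
    refine ⟨_, h.isFacet hn k, ?_, ?_⟩
    · intro h0
      have h0 := intrinsicInterior_subset h0
      have hw : ∀ m ∈ convexHull ℝ (Set.range fun i => lat (v i)), -1 ≤ dotProduct (u k) m :=
        fun m hm => (h.mem_convexHull_iff m).1 hm k
      rw [← h.setOf_apply_eq_neg_one, ← h.face_eq_convexHull hw] at h0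
      have := h0.2
      rw [dotProduct_zero] at this
      norm_num at this
    · rw [hull_convexHull]
      exact h.isFace_hull (by simp) fun i hi e => hk (e ▸ hi)

end IsSimplexAroundZero

/-! ### Rays -/

/-- A primitive lattice vector is determined by the ray that it spans. -/
theorem IsPrimitive.eq_of_lat_eq_smul {n : ℕ} {v w : Fin n → ℤ} (hv : IsPrimitive v)
    (hw : IsPrimitive w) {t : ℝ} (ht : 0 ≤ t) (h : lat w = t • lat v) : w = v := by
  obtain ⟨f, hf⟩ := Finset.gcd_eq_sum_mul .univ v
  rw [show Finset.univ.gcd v = 1 from hv] at hf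
  -- a Bézout relation for the entries of `v` shows that the factor `t` is an integer
  obtain ⟨T, hT⟩ : ∃ T : ℤ, (T : ℝ) = t := by
    refine ⟨∑ i, w i * f i, ?_⟩
    have hw' : ∀ i, (w i : ℝ) = t * v i := fun i => congrFun h i
    have hf' : (1 : ℝ) = ∑ i, (v i : ℝ) * f i := by exact_mod_cast hf
    push_cast
    simp only [hw', mul_assoc, ← Finset.mul_sum, ← hf', mul_one]
  subst hT
  have hwv : ∀ i, w i = T * v i := fun i => by
    have : (w i : ℝ) = T * v i := congrFun h i
    exact_mod_cast this
  have hdvd : T ∣ 1 := by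
    rw [← show Finset.univ.gcd w = 1 from hw]
    exact Finset.dvd_gcd fun i _ => ⟨v i, hwv i⟩
  have hT1 : T = 1 := Int.eq_one_of_dvd_one (by exact_mod_cast ht) hdvd
  funext i
  rw [hwv i, hT1, one_mul]

theorem mem_hull_singleton {n : ℕ} {x y : Fin n → ℝ} (h : x ∈ PointedCone.hull ℝ {y}) :
    ∃ t : ℝ, 0 ≤ t ∧ x = t • y := by
  obtain ⟨t, rfl⟩ := Submodule.mem_span_singleton.1 h
  exact ⟨t, t.2, rfl⟩

theorem IsPrimitive.lat_ne_zero {n : ℕ} {v : Fin n → ℤ} (hv : IsPrimitive v) : lat v ≠ 0 := by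
  intro h
  have : v = 0 := lat_injective (h.trans (by ext i; simp [lat]))
  have hv : Finset.univ.gcd v = 1 := hv
  rw [this, Finset.gcd_eq_zero_iff.2 (by simp)] at hv
  exact zero_ne_one hv

theorem rays_simplexFan {n : ℕ} {v : Fin (n + 1) → (Fin n → ℤ)} (hn : 1 ≤ n)
    (hv : ∀ i, IsPrimitive (v i)) : rays (simplexFan v) = Set.range v := by
  apply Set.Subset.antisymm
  · rintro w ⟨hw, I, hI, hwI⟩
    have hne : I.Nonempty := by
      by_contra hI0
      rw [Set.not_nonempty_iff_eq_empty] at hI0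
      have : lat w ∈ PointedCone.hull ℝ {lat w} := PointedCone.subset_hull rfl
      rw [hwI, hI0, Set.image_empty, PointedCone.hull, Submodule.span_empty] at this
      exact hw.lat_ne_zero this
    obtain ⟨i, hi⟩ := hne
    have : lat (v i) ∈ PointedCone.hull ℝ {lat w} := by
      rw [hwI]; exact PointedCone.subset_hull ⟨i, hi, rfl⟩
    obtain ⟨t, ht, e⟩ := mem_hull_singleton this
    exact ⟨i, hw.eq_of_lat_eq_smul (hv i) ht e⟩
  · rintro _ ⟨i, rfl⟩
    refine ⟨hv i, {i}, ?_, by simp⟩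
    have : Nontrivial (Fin (n + 1)) := Fin.nontrivial_iff_two_le.2 (by omega)
    obtain ⟨j, hj⟩ := exists_ne i
    exact fun e => hj (e ▸ Set.mem_univ j : j ∈ ({i} : Set _))

/-! ### The f-dual of simplices -/

theorem polyhedron_eq {n : ℕ} {D : DivisorData n} {v : Fin (n + 1) → (Fin n → ℤ)}
    {a : Fin (n + 1) → ℤ} (hrays : rays D.fan = Set.range v)
    (ha : ∀ i (hi : v i ∈ rays D.fan), D.coeff ⟨v i, hi⟩ = a i) :
    polyhedron D = {m | ∀ i, -(a i : ℝ) ≤ dotProduct m (lat (v i))} := by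
  ext m
  constructor
  · intro hm i
    have hi : v i ∈ rays D.fan := hrays ▸ Set.mem_range_self i
    have := hm ⟨v i, hi⟩
    rwa [ha i hi] at this
  · rintro hm ⟨w, hw⟩
    obtain ⟨i, rfl⟩ : w ∈ Set.range v := hrays ▸ hw
    rw [ha i hw]
    exact hm i

/-- If the integer part of `Δ_a` is a lattice simplex around the origin then `k₀ = 1`. -/
theorem fDual_fan_eq {n : ℕ} (hn : 1 ≤ n) {D : DivisorData n} {v : Fin (n + 1) → (Fin n → ℤ)}
    {c : Fin (n + 1) → ℝ} {u : Fin (n + 1) → (Fin n → ℝ)} (h : IsSimplexAroundZero v c u)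
    (hD : integerPart (polyhedron D) = convexHull ℝ (Set.range fun i => lat (v i))) :
    (fDual D).fan = simplexFan v := by
  have hmult : multiplier D = 1 := by
    -- membership of `1` also keeps `sInf` from its junk value `0`
    have hmem : 1 ∈ {k : ℕ | 1 ≤ k ∧
        (0 : Fin n → ℝ) ∈ interior (integerPart ((k : ℝ) • polyhedron D))} := by
      refine ⟨le_rfl, ?_⟩
      rw [Nat.cast_one, one_smul, hD]
      exact h.zero_mem_interior
    exact le_antisymm (Nat.sInf_le hmem) (Nat.sInf_mem ⟨1, hmem⟩).1
  change fanOver (fPolytope D) = _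
  rw [fPolytope, hmult, Nat.cast_one, one_smul, hD, h.fanOver_eq hn]

theorem fDual_coeff_eq {n : ℕ} {D : DivisorData n} {v : Fin (n + 1) → (Fin n → ℤ)}
    (hrays : rays D.fan = Set.range v) {l : Fin n → ℤ} (hl : l ∈ rays (fDual D).fan) {b : ℤ}
    (hb : 0 < b) (hle : ∀ i, 0 ≤ dotProduct (v i) l + b)
    (hmin : b = 1 ∨ ∃ i, dotProduct (v i) l + b = 0) :
    (fDual D).coeff ⟨l, hl⟩ = b := by
  lift b to ℕ using hb.le
  change ((sInf _ : ℕ) : ℤ) = _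
  rw [Nat.cast_inj]
  have hmem : b ∈ {b : ℕ | 0 < b ∧ ∀ w : rays D.fan,
      0 ≤ dotProduct (w : Fin n → ℤ) l + (b : ℤ)} := by
    refine ⟨by exact_mod_cast hb, ?_⟩
    rintro ⟨w, hw⟩
    obtain ⟨i, rfl⟩ : w ∈ Set.range v := hrays ▸ hw
    exact hle i
  apply le_antisymm (Nat.sInf_le hmem)
  obtain ⟨hpos, hall⟩ := Nat.sInf_mem ⟨b, hmem⟩
  rcases hmin with h1 | ⟨i, hi⟩
  · have : b = 1 := by exact_mod_cast h1
    exact this.trans_le hpos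
  · have := hall ⟨v i, hrays ▸ Set.mem_range_self i⟩
    simp only at this
    omega

/-! ### Projective space and its dual simplex -/

@[simp] theorem projRay_castSucc (n : ℕ) (i : Fin n) :
    projRay n i.castSucc = Pi.single i 1 := by
  simp [projRay]

@[simp] theorem projRay_last (n : ℕ) : projRay n (Fin.last n) = -1 := by
  simp [projRay]
  rfl

@[simp] theorem framing₀_castSucc (n d : ℕ) (i : Fin n) : framing₀ n d i.castSucc = 1 := by
  simp [framing₀]

@[simp] theorem framing₀_last (n d : ℕ) : framing₀ n d (Fin.last n) = d - n := by
  simp [framing₀]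

/-- The vertices `d e_i - (1, …, 1)`, `i ≤ n`, and `-(1, …, 1)` of the polytope
`{m | m_i ≥ -1, ∑ m_i ≤ d - n}` of the framing `(1, …, 1, d - n)` of `ℙⁿ`. -/
def dualRay (n d : ℕ) : Fin (n + 1) → (Fin n → ℤ) :=
  Fin.snoc (α := fun _ => Fin n → ℤ) (fun i => Pi.single i (d : ℤ) - 1) (fun _ => -1)

/-- The framing `(d - n, …, d - n, 1)` of the dual of `(ℙⁿ, (1, …, 1, d - n))`. -/
def dualFraming (n d : ℕ) : Fin (n + 1) → ℤ :=
  Fin.snoc (α := fun _ => ℤ) (fun _ : Fin n => (d : ℤ) - n) 1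

@[simp] theorem dualRay_castSucc (n d : ℕ) (i : Fin n) :
    dualRay n d i.castSucc = Pi.single i (d : ℤ) - 1 := by
  simp [dualRay]

@[simp] theorem dualRay_last (n d : ℕ) : dualRay n d (Fin.last n) = -1 := by
  simp [dualRay]
  rfl

@[simp] theorem dualFraming_castSucc (n d : ℕ) (i : Fin n) :
    dualFraming n d i.castSucc = d - n := by
  simp [dualFraming]

@[simp] theorem dualFraming_last (n d : ℕ) : dualFraming n d (Fin.last n) = 1 := by
  simp [dualFraming]

theorem lat_single {n : ℕ} (i : Fin n) (a : ℤ) : lat (Pi.single i a) = Pi.single i (a : ℝ) := by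
  ext j
  by_cases h : j = i
  · subst h; simp [lat]
  · simp [lat, h]

theorem lat_neg_one {n : ℕ} : lat (-1 : Fin n → ℤ) = -1 := by
  ext j; simp [lat]

theorem lat_sub_one {n : ℕ} (v : Fin n → ℤ) : lat (v - 1) = lat v - 1 := by
  ext j; simp [lat]

theorem isPrimitive_of_isUnit {n : ℕ} {v : Fin n → ℤ} (i : Fin n) (h : IsUnit (v i)) :
    IsPrimitive v := by
  have h1 : Finset.univ.gcd v ∣ 1 := (Finset.gcd_dvd (Finset.mem_univ i)).trans h.dvd
  have h2 := Finset.normalize_gcd (s := Finset.univ) (f := v)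
  rw [normalize_eq_one.2 (isUnit_of_dvd_one h1)] at h2
  exact h2.symm

theorem isPrimitive_projRay {n : ℕ} (hn : 2 ≤ n) (i : Fin (n + 1)) : IsPrimitive (projRay n i) := by
  induction i using Fin.lastCases with
  | last => exact isPrimitive_of_isUnit ⟨0, by omega⟩ (by simp)
  | cast i => exact isPrimitive_of_isUnit i (by simp)

theorem isPrimitive_dualRay {n : ℕ} (hn : 2 ≤ n) (d : ℕ) (i : Fin (n + 1)) :
    IsPrimitive (dualRay n d i) := by
  induction i using Fin.lastCases with
  | last => exact isPrimitive_of_isUnit ⟨0, by omega⟩ (by simp)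
  | cast i =>
    have : Nontrivial (Fin n) := Fin.nontrivial_iff_two_le.2 hn
    obtain ⟨j, hj⟩ := exists_ne i
    exact isPrimitive_of_isUnit j (by simp [hj])

theorem projRay_injective {n : ℕ} (hn : 2 ≤ n) : Function.Injective (projRay n) := by
  have : Nontrivial (Fin n) := Fin.nontrivial_iff_two_le.2 hn
  have key : ∀ i : Fin n, projRay n i.castSucc ≠ projRay n (Fin.last n) := by
    intro i h
    have := congrFun h i
    simp at this
  intro i j h
  induction i using Fin.lastCases with
  | last =>
    induction j using Fin.lastCases with
    | last => rfl
    | cast j => exact absurd h.symm (key j)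
  | cast i =>
    induction j using Fin.lastCases with
    | last => exact absurd h (key i)
    | cast j =>
      have := congrFun h i
      by_contra hij
      have hij : i ≠ j := fun e => hij (e ▸ rfl)
      simp [hij] at this

theorem isSimplexAroundZero_projRay (n : ℕ) :
    IsSimplexAroundZero (projRay n) (fun _ => 1 / (n + 1 : ℝ))
      (Fin.snoc (α := fun _ => Fin n → ℝ) (fun i => Pi.single i (n + 1 : ℝ) - 1) (-1)) where
  pos i := by positivity
  sum_eq_one := by
    simp only [Finset.sum_const, Finset.card_univ, Fintype.card_fin, nsmul_eq_mul]
    push_cast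
    field_simp
  relation := by
    rw [Fin.sum_univ_castSucc]
    ext j
    simp [lat_single, lat_neg_one, Finset.sum_apply, Pi.single_apply]
  expand x := by
    have hn : (n + 1 : ℝ) ≠ 0 := by positivity
    rw [Fin.sum_univ_castSucc]
    ext j
    simp [lat_single, lat_neg_one, Finset.sum_apply, Pi.single_apply, sub_dotProduct]
    field_simp
    ring
  apply_self i := by
    induction i using Fin.lastCases with
    | last => simp [lat_neg_one]
    | cast i => simp [lat_single]
  apply_ne i j hij := by
    induction i using Fin.lastCases with
    | last =>
      induction j using Fin.lastCases with
      | last => exact absurd rfl hij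
      | cast j => simp [lat_single]
    | cast i =>
      induction j using Fin.lastCases with
      | last => simp [lat_neg_one, sub_dotProduct]
      | cast j =>
        have hij : i ≠ j := fun e => hij (e ▸ rfl)
        simp [lat_single, hij]

theorem isSimplexAroundZero_dualRay {n d : ℕ} (hd : n + 1 ≤ d) :
    IsSimplexAroundZero (dualRay n d)
      (Fin.snoc (α := fun _ => ℝ) (fun _ : Fin n => 1 / (d : ℝ)) ((d - n) / d))
      (Fin.snoc (α := fun _ => Fin n → ℝ) (fun i => Pi.single i 1)
        (fun _ => -(1 / ((d : ℝ) - n)))) := by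
  have hd0 : (0 : ℝ) < d := by exact_mod_cast (by omega : 0 < d)
  have hdn : (0 : ℝ) < d - n := by
    have : ((n + 1 : ℕ) : ℝ) ≤ d := by exact_mod_cast hd
    push_cast at this
    linarith
  have hlast : ∀ x : Fin n → ℝ, dotProduct (fun _ => -(1 / ((d : ℝ) - n))) x =
      -(1 / ((d : ℝ) - n)) * ∑ i, x i := fun x => by
    simp only [dotProduct, Finset.mul_sum]
  refine ⟨?_, ?_, ?_, ?_, ?_, ?_⟩
  · intro i
    induction i using Fin.lastCases with
    | last => simp only [Fin.snoc_last]; positivity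
    | cast i => simp only [Fin.snoc_castSucc]; positivity
  · rw [Fin.sum_univ_castSucc]
    simp only [Fin.snoc_last, Fin.snoc_castSucc, Finset.sum_const, Finset.card_univ,
      Fintype.card_fin, nsmul_eq_mul]
    field_simp
    ring
  · rw [Fin.sum_univ_castSucc]
    ext j
    simp [lat_single, lat_neg_one, lat_sub_one, Finset.sum_apply, Pi.single_apply, mul_sub]
    field_simp
    ring
  · intro x
    rw [Fin.sum_univ_castSucc]
    ext j
    simp only [Fin.snoc_last, Fin.snoc_castSucc, hlast]
    simp [lat_single, lat_neg_one, lat_sub_one, Finset.sum_apply, Pi.single_apply, mul_sub,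
      ← Finset.mul_sum]
    field_simp
    ring
  · intro i
    induction i using Fin.lastCases with
    | last =>
      simp only [Fin.snoc_last, hlast, dualRay_last, lat_neg_one]
      simp
      field_simp
      ring
    | cast i => simp [lat_single, lat_sub_one]
  · intro i j hij
    induction i using Fin.lastCases with
    | last =>
      induction j using Fin.lastCases with
      | last => exact absurd rfl hij
      | cast j =>
        simp only [Fin.snoc_last, hlast, dualRay_castSucc, lat_sub_one, lat_single]
        simp
        field_simp
    | cast i =>
      induction j using Fin.lastCases with
      | last => simp [lat_neg_one]
      | cast j =>
        have hij : i ≠ j := fun e => hij (e ▸ rfl)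
        simp [lat_single, lat_sub_one, hij]

theorem rays_projFan {n : ℕ} (hn : 2 ≤ n) : rays (projFan n) = Set.range (projRay n) :=
  rays_simplexFan (by omega) (isPrimitive_projRay hn)

theorem projData_coeff {n : ℕ} (hn : 2 ≤ n) (a : Fin (n + 1) → ℤ) (i : Fin (n + 1))
    (hi : projRay n i ∈ rays (projData n a).fan) :
    (projData n a).coeff ⟨projRay n i, hi⟩ = a i := by
  simp [projData, (projRay_injective hn).eq_iff]

theorem isFramed_projData {n : ℕ} (hn : 2 ≤ n) {a : Fin (n + 1) → ℤ} (ha : ∀ i, 0 < a i) :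
    IsFramed (projData n a) where
  isFan := (isSimplexAroundZero_projRay n).isFan
  complete := (isSimplexAroundZero_projRay n).isComplete
  pos := by
    rintro ⟨w, hw⟩
    obtain ⟨i, rfl⟩ : w ∈ Set.range (projRay n) := rays_projFan hn ▸ hw
    rw [projData_coeff hn]
    exact ha i

theorem framing₀_pos {n d : ℕ} (hd : n + 1 ≤ d) (i : Fin (n + 1)) : 0 < framing₀ n d i := by
  induction i using Fin.lastCases with
  | last => rw [framing₀_last]; omega
  | cast i => simp

/-- The polytope of the framing `(1, …, 1, d - n)` is already a lattice simplex. -/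
theorem integerPart_polyhedron_projData {n d : ℕ} (hn : 2 ≤ n) (hd : n + 1 ≤ d) :
    integerPart (polyhedron (projData n (framing₀ n d))) =
      convexHull ℝ (Set.range fun i => lat (dualRay n d i)) := by
  have hdn : (0 : ℝ) < d - n := by
    have : ((n + 1 : ℕ) : ℝ) ≤ d := by exact_mod_cast hd
    push_cast at this
    linarith
  have hpoly : polyhedron (projData n (framing₀ n d)) =
      convexHull ℝ (Set.range fun i => lat (dualRay n d i)) := by
    rw [polyhedron_eq (rays_projFan hn) (projData_coeff hn _)]
    ext m
    rw [(isSimplexAroundZero_dualRay hd).mem_convexHull_iff]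
    refine forall_congr' fun i => ?_
    induction i using Fin.lastCases with
    | last =>
      have : dotProduct (fun _ => -(1 / ((d : ℝ) - n))) m = -((∑ i, m i) / ((d : ℝ) - n)) := by
        simp only [dotProduct, ← Finset.mul_sum]
        ring
      simp only [framing₀_last, projRay_last, lat_neg_one, Fin.snoc_last, this,
        dotProduct_neg, dotProduct_one, neg_le_neg_iff, div_le_one hdn]
      push_cast
      rfl
    | cast i => simp [lat_single]
  rw [integerPart, hpoly]
  apply Set.Subset.antisymm
  · exact convexHull_min Set.inter_subset_left (convex_convexHull ℝ _)
  · refine convexHull_mono ?_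
    rintro _ ⟨i, rfl⟩
    exact ⟨subset_convexHull ℝ _ ⟨i, rfl⟩, _, rfl⟩

theorem fDual_projData_fan {n d : ℕ} (hn : 2 ≤ n) (hd : n + 1 ≤ d) :
    (fDual (projData n (framing₀ n d))).fan = simplexFan (dualRay n d) :=
  fDual_fan_eq (by omega) (isSimplexAroundZero_dualRay hd) (integerPart_polyhedron_projData hn hd)

theorem rays_fDual_projData {n d : ℕ} (hn : 2 ≤ n) (hd : n + 1 ≤ d) :
    rays (fDual (projData n (framing₀ n d))).fan = Set.range (dualRay n d) := by
  rw [fDual_projData_fan hn hd, rays_simplexFan (by omega) (isPrimitive_dualRay hn d)]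

theorem fDual_projData_coeff {n d : ℕ} (hn : 2 ≤ n) (hd : n + 1 ≤ d) (i : Fin (n + 1))
    (hi : dualRay n d i ∈ rays (fDual (projData n (framing₀ n d))).fan) :
    (fDual (projData n (framing₀ n d))).coeff ⟨dualRay n d i, hi⟩ = dualFraming n d i := by
  induction i using Fin.lastCases with
  | last =>
    refine fDual_coeff_eq (rays_projFan hn) hi (by simp) (fun j => ?_) (Or.inl (by simp))
    induction j using Fin.lastCases with
    | last => simp; positivity
    | cast j => simp
  | cast i =>
    refine fDual_coeff_eq (rays_projFan hn) hi (by simp; omega) (fun j => ?_)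
      (Or.inr ⟨Fin.last n, by simp⟩)
    induction j using Fin.lastCases with
    | last => simp
    | cast j =>
      simp only [projRay_castSucc, dualRay_castSucc, dualFraming_castSucc, single_one_dotProduct,
        Pi.sub_apply, Pi.one_apply, Pi.single_apply]
      split_ifs <;> omega

/-- The lattice points of the polyhedron of the dual framing are the rays of `ℙⁿ` and the origin. -/
theorem eq_zero_or_mem_range_projRay {n d : ℕ} (hd : n + 1 ≤ d) {m : Fin n → ℤ}
    (hm : ∀ i, -dualFraming n d i ≤ dotProduct m (dualRay n d i)) :
    m = 0 ∨ m ∈ Set.range (projRay n) := by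
  set s := ∑ i, m i with hs
  have hs1 : s ≤ 1 := by simpa [dotProduct_one] using hm (Fin.last n)
  have hmi : ∀ i, s - d + n ≤ d * m i := by
    intro i
    have := hm i.castSucc
    simp [dotProduct_sub, dotProduct_one, ← hs] at this
    linarith
  have hd' : (n : ℤ) + 1 ≤ d := by exact_mod_cast hd
  rcases lt_or_ge (-(n : ℤ)) s with hsn | hsn
  · have hnn : ∀ i, 0 ≤ m i := by
      intro i
      by_contra hi
      push Not at hi
      -- `m i ≤ -1` would give `s - d + n ≤ -d`
      nlinarith [hmi i]
    have hs0 : 0 ≤ s := Finset.sum_nonneg fun i _ => hnn i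
    obtain hs0 | hs1 : s = 0 ∨ s = 1 := by omega
    · left
      funext i
      exact (Finset.sum_eq_zero_iff_of_nonneg fun i _ => hnn i).1 hs0 i (Finset.mem_univ i)
    · right
      obtain ⟨i, -, hi⟩ : ∃ i ∈ Finset.univ, m i ≠ 0 := by
        apply Finset.exists_ne_zero_of_sum_ne_zero
        omega
      have hi1 : 1 ≤ m i := by have := hnn i; omega
      have hrest : ∑ j ∈ Finset.univ.erase i, m j + m i = 1 := by
        rw [Finset.sum_erase_add _ _ (Finset.mem_univ i), ← hs, hs1]
      have hrest0 : 0 ≤ ∑ j ∈ Finset.univ.erase i, m j := Finset.sum_nonneg fun j _ => hnn j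
      have hz := (Finset.sum_eq_zero_iff_of_nonneg fun j _ => hnn j).1
        (show ∑ j ∈ Finset.univ.erase i, m j = 0 by omega)
      refine ⟨i.castSucc, ?_⟩
      rw [projRay_castSucc]
      funext j
      by_cases hj : j = i
      · subst hj
        rw [Pi.single_eq_same]
        omega
      · rw [Pi.single_eq_of_ne hj]
        exact (hz j (by simp [hj])).symm
  · -- summing the inequalities `hmi` gives `s ≥ -n`, so `s = -n` and every coordinate is `-1`
    right
    have hsum : (n : ℤ) * (s - d + n) ≤ d * s := by
      calc (n : ℤ) * (s - d + n) = ∑ _i : Fin n, (s - d + n) := by simp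
        _ ≤ ∑ i, d * m i := Finset.sum_le_sum fun i _ => hmi i
        _ = d * s := by rw [hs, Finset.mul_sum]
    have hsn' : s = -n := by nlinarith
    have hge : ∀ i, 0 ≤ m i + 1 := by
      intro i
      by_contra hi
      push Not at hi
      nlinarith [hmi i]
    have hz := (Finset.sum_eq_zero_iff_of_nonneg fun j _ => hge j).1
      (show ∑ j : Fin n, (m j + 1) = 0 by
        rw [Finset.sum_add_distrib, ← hs, hsn']; simp)
    refine ⟨Fin.last n, ?_⟩
    rw [projRay_last]
    funext j
    have := hz j (Finset.mem_univ j)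
    simp only [Pi.neg_apply, Pi.one_apply]
    omega

theorem lat_dotProduct_lat {n : ℕ} (v w : Fin n → ℤ) :
    dotProduct (lat v) (lat w) = ((dotProduct v w : ℤ) : ℝ) := by
  simp [lat, dotProduct]

theorem projRay_mem_polyhedron {n d : ℕ} (hn : 2 ≤ n) (hd : n + 1 ≤ d) (i : Fin (n + 1)) :
    lat (projRay n i) ∈ polyhedron (fDual (projData n (framing₀ n d))) := by
  rw [polyhedron_eq (rays_fDual_projData hn hd) (fDual_projData_coeff hn hd)]
  intro j
  rw [lat_dotProduct_lat]
  norm_cast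
  induction i using Fin.lastCases with
  | last =>
    induction j using Fin.lastCases with
    | last => simp
    | cast j => simp
  | cast i =>
    induction j using Fin.lastCases with
    | last => simp
    | cast j =>
      simp only [projRay_castSucc, dualRay_castSucc, dualFraming_castSucc, single_one_dotProduct,
        Pi.sub_apply, Pi.one_apply, Pi.single_apply]
      split_ifs <;> omega

/-- The polyhedron of the dual framing need not be a lattice polytope, but its integer part is the
simplex spanned by the rays of `ℙⁿ`. -/
theorem integerPart_polyhedron_fDual_projData {n d : ℕ} (hn : 2 ≤ n) (hd : n + 1 ≤ d) :
    integerPart (polyhedron (fDual (projData n (framing₀ n d)))) =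
      convexHull ℝ (Set.range fun i => lat (projRay n i)) := by
  apply Set.Subset.antisymm
  · refine convexHull_min ?_ (convex_convexHull ℝ _)
    rintro _ ⟨hm, m, rfl⟩
    rw [polyhedron_eq (rays_fDual_projData hn hd) (fDual_projData_coeff hn hd)] at hm
    have hm' : ∀ i, -dualFraming n d i ≤ dotProduct m (dualRay n d i) := by
      intro i
      have := hm i
      rw [lat_dotProduct_lat] at this
      exact_mod_cast this
    rcases eq_zero_or_mem_range_projRay hd hm' with rfl | ⟨i, rfl⟩
    · rw [show lat (0 : Fin n → ℤ) = 0 by ext i; simp [lat]]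
      exact interior_subset (isSimplexAroundZero_projRay n).zero_mem_interior
    · exact subset_convexHull ℝ _ ⟨i, rfl⟩
  · refine convexHull_mono ?_
    rintro _ ⟨i, rfl⟩
    exact ⟨projRay_mem_polyhedron hn hd i, _, rfl⟩

theorem fDual_fDual_projData_fan {n d : ℕ} (hn : 2 ≤ n) (hd : n + 1 ≤ d) :
    (fDual (fDual (projData n (framing₀ n d)))).fan = projFan n :=
  fDual_fan_eq (by omega) (isSimplexAroundZero_projRay n)
    (integerPart_polyhedron_fDual_projData hn hd)

theorem DivisorData.ext_of_coeff {n : ℕ} {D D' : DivisorData n} (hfan : D.fan = D'.fan)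
    (hcoeff : ∀ v (h : v ∈ rays D.fan) (h' : v ∈ rays D'.fan), D.coeff ⟨v, h⟩ = D'.coeff ⟨v, h'⟩) :
    D = D' := by
  obtain ⟨F, a⟩ := D
  obtain ⟨F', a'⟩ := D'
  obtain rfl : F = F' := hfan
  congr 1
  funext ⟨v, hv⟩
  exact hcoeff v hv hv

/-- The f-process of `(ℙⁿ, (1, …, 1, d - n))` returns to its starting point. -/
theorem fDual_fDual_projData {n d : ℕ} (hn : 2 ≤ n) (hd : n + 1 ≤ d) :
    fDual (fDual (projData n (framing₀ n d))) = projData n (framing₀ n d) := by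
  refine DivisorData.ext_of_coeff (fDual_fDual_projData_fan hn hd) fun w hw hw' => ?_
  obtain ⟨i, rfl⟩ : w ∈ Set.range (projRay n) := rays_projFan hn ▸ hw'
  rw [projData_coeff hn]
  refine fDual_coeff_eq (rays_fDual_projData hn hd) hw (framing₀_pos hd i) (fun j => ?_) ?_
  · induction i using Fin.lastCases with
    | last =>
      induction j using Fin.lastCases with
      | last => simp
      | cast j => simp
    | cast i =>
      induction j using Fin.lastCases with
      | last => simp
      | cast j =>
        simp only [projRay_castSucc, dualRay_castSucc, framing₀_castSucc, dotProduct_single_one,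
          Pi.sub_apply, Pi.one_apply, Pi.single_apply]
        split_ifs <;> omega
  · induction i using Fin.lastCases with
    | last =>
      obtain ⟨j⟩ : Nonempty (Fin n) := ⟨⟨0, by omega⟩⟩
      exact Or.inr ⟨j.castSucc, by simp⟩
    | cast i => exact Or.inl (by simp)

/-! ### Calibration of an f-process that returns to its starting point -/

theorem affineToricMap_comp_chart {n : ℕ} {𝓕 : Set (Cone n)} {τ σ : 𝓕}
    (h : (τ : Cone n) ≤ σ) : affineToricMap h ≫ chart σ = chart τ :=
  colimit.w (toricDiagram 𝓕) (homOfLE h)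

theorem torusInclusion_eq_of_le {n : ℕ} {𝓕 : Set (Cone n)} {τ σ : 𝓕}
    (h : (τ : Cone n) ≤ σ) : torusInclusion σ = torusInclusion τ := by
  rw [torusInclusion, torusInclusion, ← affineToricMap_comp_chart h, affineToricMap,
    ← Category.assoc, ← Functor.map_comp, ← op_comp]
  congr 3
  rw [coordMap, ← CommRingCat.ofHom_comp, ← AddMonoidAlgebra.mapDomainRingHom_comp]
  rfl

theorem torusInclusion_eq {n : ℕ} {𝓕 : Set (Cone n)} (h𝓕 : IsFan 𝓕) (σ σ' : 𝓕) :
    torusInclusion σ = torusInclusion σ' := by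
  have hmem : (σ : Cone n) ⊓ σ' ∈ 𝓕 :=
    h𝓕.face_mem _ σ.2 _ (h𝓕.inter_face _ σ.2 _ σ'.2).1
  rw [torusInclusion_eq_of_le (τ := ⟨_, hmem⟩) (σ := σ) inf_le_left,
    torusInclusion_eq_of_le (τ := ⟨_, hmem⟩) (σ := σ') inf_le_right]

theorem isToricIso_refl {n : ℕ} {𝓕 : Set (Cone n)} (h𝓕 : IsFan 𝓕) :
    IsToricIso (Iso.refl (toricVariety 𝓕)) := by
  refine ⟨BialgEquiv.refl ℂ _, fun σ σ' => ?_⟩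
  rw [Iso.refl_hom, Category.comp_id, torusInclusion_eq h𝓕 σ σ']
  exact ((congrArg (· ≫ torusInclusion σ') (Spec.toLocallyRingedSpace.map_id _)).trans
    (Category.id_comp _)).symm

theorem isRefinementMap_id {n : ℕ} (𝓕 : Set (Cone n)) :
    IsRefinementMap (𝟙 (toricVariety 𝓕)) := by
  intro τ σ h
  rw [Category.comp_id, affineToricMap_comp_chart]

/-- If the fan is simplicial and the f-process returns to its starting point, then the identity maps
calibrate it. -/
theorem isCalibrated_of_fDual_fDual_eq {n : ℕ} {D : DivisorData n} (hD : fDual (fDual D) = D)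
    (hfan : IsFan D.fan) (hcomplete : IsComplete D.fan)
    (hsimp : ∀ σ ∈ D.fan, σ.IsSimplicial) : IsCalibrated D := by
  unfold IsCalibrated
  rw [hD]
  refine ⟨D.fan, ⟨hfan, hcomplete, hsimp, rfl⟩, D.fan, ⟨hfan, hcomplete, hsimp, rfl⟩,
    fun τ hτ => ⟨τ, hτ, le_rfl⟩, fun τ hτ => ⟨τ, hτ, le_rfl⟩, 𝟙 _, 𝟙 _, Iso.refl _,
    isRefinementMap_id _, isRefinementMap_id _, isToricIso_refl hfan, ?_⟩
  rw [Iso.refl_hom, Category.comp_id]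

/-! ### Linear equivalence of hypersurfaces -/

attribute [local instance] MvPolynomial.gradedAlgebra

/-- The monomial `∏ X_i ^ a_i` vanishes to the order `a_i` along `X_i = 0`, and nowhere else. -/
theorem ordAlong_prod_X_pow {n : ℕ} (a : Fin (n + 1) → ℕ) (P : ProjPrimeDivisor n) :
    ordAlong P (∏ i, MvPolynomial.X i ^ a i) = coordDivisor (fun i => (a i : ℤ)) P := by
  classical
  have hprime : P.1.asHomogeneousIdeal.toIdeal.IsPrime := P.1.isPrime
  have hheight := P.2
  rw [ordAlong, coordDivisor]
  generalize P.1.asHomogeneousIdeal.toIdeal = 𝔭 at hprime hheight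
  by_cases hX : ∃ i, MvPolynomial.X i ∈ 𝔭
  · obtain ⟨i, hi⟩ := hX
    have hXi : Prime (MvPolynomial.X i : MvPolynomial (Fin (n + 1)) ℂ) := MvPolynomial.X_prime
    have hspan : (Ideal.span {(MvPolynomial.X i : MvPolynomial (Fin (n + 1)) ℂ)}).IsPrime :=
      (Ideal.span_singleton_prime hXi.ne_zero).2 hXi
    -- a prime of height one containing `X i` is generated by it
    have h𝔭 : 𝔭 = Ideal.span {MvPolynomial.X i} := by
      by_contra hne
      have hlt : Ideal.span {MvPolynomial.X i} < 𝔭 :=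
        lt_of_le_of_ne ((Ideal.span_singleton_le_iff_mem _).2 hi) (Ne.symm hne)
      have h1 := Ideal.height_add_one_le_of_lt_of_isPrime hlt
      rw [hheight] at h1
      have h0 : (Ideal.span {(MvPolynomial.X i : MvPolynomial (Fin (n + 1)) ℂ)}).height = 0 := by
        have : (Ideal.span {(MvPolynomial.X i : MvPolynomial (Fin (n + 1)) ℂ)}).height + 1
            ≤ 0 + 1 := by simpa using h1
        exact nonpos_iff_eq_zero.1 ((ENat.add_le_add_iff_right ENat.one_ne_top).1 this)
      rw [Ideal.height_eq_zero_iff_eq_bot, Ideal.span_singleton_eq_bot] at h0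
      exact hXi.ne_zero h0
    have hinj : ∀ j, Ideal.span {(MvPolynomial.X i : MvPolynomial (Fin (n + 1)) ℂ)} =
        Ideal.span {MvPolynomial.X j} ↔ i = j := by
      intro j
      constructor
      · intro h
        rw [Ideal.span_singleton_eq_span_singleton] at h
        exact MvPolynomial.X_dvd_X.1 h.dvd
      · rintro rfl; rfl
    have hset : {k : ℕ | ∏ j, (MvPolynomial.X j : MvPolynomial (Fin (n + 1)) ℂ) ^ a j ∈ 𝔭 ^ k} =
        Set.Iic (a i) := by
      ext k
      rw [Set.mem_ofPred_eq, h𝔭, Ideal.span_singleton_pow, Ideal.mem_span_singleton, Set.mem_Iic,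
        ← Finset.mul_prod_erase _ _ (Finset.mem_univ i)]
      constructor
      · intro h
        have hnot : ¬ MvPolynomial.X i ∣ ∏ j ∈ Finset.univ.erase i,
            (MvPolynomial.X j : MvPolynomial (Fin (n + 1)) ℂ) ^ a j := by
          rw [hXi.dvd_finsetProd_iff]
          rintro ⟨j, hj, hdvd⟩
          exact Finset.ne_of_mem_erase hj
            (MvPolynomial.X_dvd_X.1 (hXi.dvd_of_dvd_pow hdvd)).symm
        exact (pow_dvd_pow_iff hXi.ne_zero hXi.not_isUnit).1
          (hXi.pow_dvd_of_dvd_mul_right k hnot h)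
      · intro h
        exact (pow_dvd_pow _ h).mul_right _
    rw [hset, csSup_Iic]
    simp only [h𝔭, hinj]
    simp
  · push Not at hX
    have hset : {k : ℕ | ∏ j, (MvPolynomial.X j : MvPolynomial (Fin (n + 1)) ℂ) ^ a j ∈ 𝔭 ^ k} =
        {0} := by
      ext k
      rw [Set.mem_ofPred_eq, Set.mem_singleton_iff]
      constructor
      · intro h
        by_contra hk
        have := Ideal.pow_le_self hk h
        rw [hprime.prod_mem_iff] at this
        obtain ⟨j, -, hj⟩ := this
        exact hX j (hprime.mem_of_pow_mem _ hj)
      · rintro rfl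
        simp
    rw [hset, csSup_singleton, Finset.sum_eq_zero, Nat.cast_zero]
    intro i _
    rw [if_neg]
    rintro rfl
    exact hX i (Ideal.mem_span_singleton_self _)

/-- A hypersurface of degree `∑ a_i` differs from `∑ a_i D_i` by the divisor of the quotient of its
equation by the monomial `∏ X_i ^ a_i`. -/
theorem linearlyEquivalent_coordDivisor {n : ℕ} (a : Fin (n + 1) → ℕ)
    {F : MvPolynomial (Fin (n + 1)) ℂ} (hF : F ≠ 0) (hhom : F.IsHomogeneous (∑ i, a i)) :
    LinearlyEquivalent (hypersurface F) (coordDivisor fun i => (a i : ℤ)) := by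
  refine ⟨_, F, ∏ i, MvPolynomial.X i ^ a i, hF, ?_, hhom, ?_, fun P => ?_⟩
  · exact Finset.prod_ne_zero_iff.2 fun i _ => pow_ne_zero _ (MvPolynomial.X_ne_zero i)
  · exact MvPolynomial.IsHomogeneous.prod _ _ _ fun i _ => MvPolynomial.isHomogeneous_X_pow i _
  · rw [ordAlong_prod_X_pow, hypersurface]

theorem framing₀_eq_natCast {n d : ℕ} (hd : n ≤ d) : framing₀ n d =
    fun i => ((Fin.snoc (α := fun _ => ℕ) (fun _ : Fin n => 1) (d - n) i : ℕ) : ℤ) := by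
  funext i
  induction i using Fin.lastCases with
  | last => simp [hd]
  | cast i => simp

end FDuality

theorem corollary3 (n d : ℕ) (hn : 2 ≤ n) (hd : n + 1 ≤ d) :
    FDuality.IsFramed (FDuality.projData n (FDuality.framing₀ n d)) ∧
    (∀ F : MvPolynomial (Fin (n + 1)) ℂ, F ≠ 0 → F.IsHomogeneous d →
      FDuality.LinearlyEquivalent (FDuality.hypersurface F)
        (FDuality.coordDivisor (FDuality.framing₀ n d))) ∧
    FDuality.IsCalibrated (FDuality.projData n (FDuality.framing₀ n d)) := by
  refine ⟨FDuality.isFramed_projData hn (FDuality.framing₀_pos hd), fun F hF hhom => ?_, ?_⟩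
  · rw [FDuality.framing₀_eq_natCast (by omega)]
    refine FDuality.linearlyEquivalent_coordDivisor _ hF ?_
    convert hhom
    rw [Fin.sum_univ_castSucc]
    simp
    omega
  · have h := FDuality.isSimplexAroundZero_projRay n
    exact FDuality.isCalibrated_of_fDual_fDual_eq (FDuality.fDual_fDual_projData hn hd)
      h.isFan h.isComplete fun σ hσ => h.isSimplicial hσ
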